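/- Let $X$ be a Borel (that is, measurable) space and let $\mu$ be a $\sigma$-finite measure on $X$. All Hilbert spaces are complex, and $\otimes$ between Hilbert spaces is the Hilbert space (completed) tensor product. A measurable field of Hilbert spaces $\mathcal H$ on $X$ is a family $(\mathcal H_x)_{x\in X}$ of Hilbert spaces with a linear subspace $\mathcal M_{\mathcal H}\subseteq\prod_{x}\mathcal H_x$ (the measurable sections) such that: (1) $x\mapsto\|\xi(x)\|$ is measurable for every $\xi\in\mathcal M_{\mathcal H}$; (2) if $\eta\in\prod_x\mathcal H_x$ and $x\mapsto\langle\eta(x)\,|\,\xi(x)\rangle$ is measurable for every $\xi\in\mathcal M_{\mathcal H}$, then $\eta\in\mathcal M_{\mathcal H}$; (3) there is a sequence $(\xi_i)$ in $\mathcal M_{\mathcal H}$ (a fundamental sequence) such that $\{\xi_i(x)\}_i$ is dense in $\mathcal H_x$ for every $x$. A bounded field of operators $\alpha:\mathcal H\to\mathcal H'$ is a family of bounded operators $\alpha_x:\mathcal H_x\to\mathcal H'_x$ with $\sup_x\|\alpha_x\|<\infty$ that carries $\mathcal M_{\mathcal H}$ into $\mathcal M_{\mathcal H'}$. The direct integral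 $\int_X^\oplus\mathcal H_x\,d\mu(x)$ is the Hilbert space of all $\xi\in\mathcal M_{\mathcal H}$ with $\int_X\|\xi(x)\|^2d\mu(x)<\infty$, modulo equality $\mu$-almost everywhere, with scalar product $\int_X\langle\xi(x)\,|\,\zeta(x)\rangle\,d\mu(x)$; the class of $\xi$ is written $\int_X^\oplus\xi(x)\,d\mu(x)$, and $\int_X^\oplus\alpha_x\,d\mu(x)$ is the bounded operator that sends the class of $\xi$ to the class of $x\mapsto\alpha_x(\xi(x))$. For a separable Hilbert space $K$, the measurable field $\mathcal H\otimes K$ has fibre $\mathcal H_x\otimes K$ at $x$, and $\mathcal M_{\mathcal H\otimes K}$ consists of all sections whose scalar product with every section $x\mapsto\xi(x)\otimes k$ ($\xi\in\mathcal M_{\mathcal H}$, $k\in K$) is measurable; equivalently, whose scalar products with all finite linear combinations, with algebraic coefficients, of sections $x\mapsto\xi_i(x)\otimes k_j$ are measurable, where $(\xi_i)$ is a fundamental sequence of $\mathcal H$ and $(k_j)$ is a dense sequence in $K$. **Theorem.** There are isometric isomorphisms of Hilbert spaces $$\Phi_{\mathcal H,K}:\int_X^\oplus(\mathcal H_x\otimes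 K)\,d\mu(x)\;\xrightarrow{\ \cong\ }\;\Big(\int_X^\oplus\mathcal H_x\,d\mu(x)\Big)\otimes K,$$ one for each measurable field of Hilbert spaces $\mathcal H$ on $X$ and each separable Hilbert space $K$, that are canonical, in the sense that $$\Phi_{\mathcal H,K}\Big(\int_X^\oplus\xi(x)\otimes k\,d\mu(x)\Big)=\Big(\int_X^\oplus\xi(x)\,d\mu(x)\Big)\otimes k$$ for every square-integrable measurable section $\xi$ of $\mathcal H$ and every $k\in K$, and natural in both variables: for every bounded field of operators $\alpha:\mathcal H\to\mathcal H'$ and every bounded operator $f:K\to K'$ between separable Hilbert spaces, $$\Phi_{\mathcal H',K'}\circ\int_X^\oplus(\alpha_x\otimes f)\,d\mu(x)=\Big(\int_X^\oplus\alpha_x\,d\mu(x)\ \otimes f\Big)\circ\Phi_{\mathcal H,K}.$$ -/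

import Mathlib

open MeasureTheory UniformSpace
open scoped TensorProduct

universe u v w

noncomputable section

/-! ### The Hilbert space tensor product -/

section HilbertTensor

/-- The Hilbert space tensor product: the completion of the algebraic tensor product with respect
to the inner product `⟪a ⊗ b, c ⊗ d⟫ = ⟪a, c⟫ * ⟪b, d⟫`. -/
abbrev HilbertTensor (E : Type v) (F : Type w) [NormedAddCommGroup E] [InnerProductSpace ℂ E]
    [NormedAddCommGroup F] [InnerProductSpace ℂ F] : Type (max v w) :=
  Completion (E ⊗[ℂ] F)

variable {E E' F F' : Type*} [NormedAddCommGroup E] [InnerProductSpace ℂ E]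
  [NormedAddCommGroup E'] [InnerProductSpace ℂ E']
  [NormedAddCommGroup F] [InnerProductSpace ℂ F]
  [NormedAddCommGroup F'] [InnerProductSpace ℂ F']

namespace HilbertTensor

/-- The elementary tensor `e ⊗ f`. -/
def tmul (e : E) (f : F) : HilbertTensor E F := ((e ⊗ₜ[ℂ] f : E ⊗[ℂ] F) : Completion (E ⊗[ℂ] F))

theorem inner_tmul (e e' : E) (f f' : F) :
    inner ℂ (tmul e f) (tmul e' f') = inner ℂ e e' * inner ℂ f f' := by
  simp [tmul, Completion.inner_coe]

theorem norm_tmul (e : E) (f : F) : ‖tmul e f‖ = ‖e‖ * ‖f‖ := by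
  simp [tmul]

theorem continuous_tmul : Continuous fun p : E × F => tmul p.1 p.2 :=
  (Completion.continuous_coe _).comp TensorProduct.continuous_tmul

/-- The tensor product `f ⊗ g` of bounded operators: the continuous extension of the
operator `a ⊗ b ↦ f a ⊗ g b`. -/
def map (f : E →L[ℂ] E') (g : F →L[ℂ] F') : HilbertTensor E F →L[ℂ] HilbertTensor E' F' :=
  ((Completion.toComplL : E' ⊗[ℂ] F' →L[ℂ] Completion (E' ⊗[ℂ] F')) ∘L
    TensorProduct.mapL f g).extend (Completion.toComplL : E ⊗[ℂ] F →L[ℂ] Completion (E ⊗[ℂ] F))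

theorem map_coe (f : E →L[ℂ] E') (g : F →L[ℂ] F') (t : E ⊗[ℂ] F) :
    map f g (t : Completion (E ⊗[ℂ] F)) = (TensorProduct.mapL f g t : Completion (E' ⊗[ℂ] F')) :=
  ContinuousLinearMap.extend_eq _ Completion.denseRange_coe (Completion.isUniformInducing_coe _) t

theorem map_tmul (f : E →L[ℂ] E') (g : F →L[ℂ] F') (e : E) (k : F) :
    map f g (tmul e k) = tmul (f e) (g k) := by
  rw [tmul, map_coe, TensorProduct.mapL_tmul, tmul]

theorem norm_map_le (f : E →L[ℂ] E') (g : F →L[ℂ] F') : ‖map f g‖ ≤ ‖f‖ * ‖g‖ := by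
  refine ContinuousLinearMap.opNorm_le_bound _ (by positivity) fun t => ?_
  induction t using Completion.induction_on with
  | hp => exact isClosed_le (by fun_prop) (by fun_prop)
  | ih t =>
    rw [map_coe, Completion.norm_coe, Completion.norm_coe]
    exact ((TensorProduct.mapL f g).le_opNorm t).trans
      (mul_le_mul_of_nonneg_right (TensorProduct.norm_mapL_le f g) (norm_nonneg _))

theorem eq_top_of_tmul_mem (S : AddSubmonoid (HilbertTensor E F))
    (hS : IsClosed (S : Set (HilbertTensor E F))) (h : ∀ e f, tmul e f ∈ S) (t) : t ∈ S := by
  induction t using Completion.induction_on with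
  | hp => exact hS
  | ih t =>
    induction t using TensorProduct.induction_on with
    | zero => rw [Completion.coe_zero]; exact S.zero_mem
    | tmul e f => exact h e f
    | add a b ha hb => rw [Completion.coe_add]; exact S.add_mem ha hb

theorem inner_map_tmul [CompleteSpace E] [CompleteSpace E'] [CompleteSpace F] [CompleteSpace F']
    (f : E →L[ℂ] E') (g : F →L[ℂ] F') (t : HilbertTensor E F) (e' : E') (k' : F') :
    inner ℂ (map f g t) (tmul e' k') = inner ℂ t (tmul (f.adjoint e') (g.adjoint k')) := by
  let S : AddSubmonoid (HilbertTensor E F) :=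
    { carrier := {t | inner ℂ (map f g t) (tmul e' k') =
        inner ℂ t (tmul (f.adjoint e') (g.adjoint k'))}
      zero_mem' := by simp
      add_mem' := by
        intro a b ha hb
        simp only [Set.mem_ofPred_eq, map_add, inner_add_left] at *
        rw [ha, hb] }
  refine eq_top_of_tmul_mem S (isClosed_eq (by fun_prop) (by fun_prop)) (fun e k => ?_) t
  change inner ℂ (map f g (tmul e k)) (tmul e' k') =
    inner ℂ (tmul e k) (tmul (f.adjoint e') (g.adjoint k'))
  rw [map_tmul, inner_tmul, inner_tmul, ContinuousLinearMap.adjoint_inner_right,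
    ContinuousLinearMap.adjoint_inner_right]

end HilbertTensor

end HilbertTensor

/-! ### Measurable fields of Hilbert spaces -/

section Closure

variable {X : Type u} [MeasurableSpace X] {F : X → Type v} [∀ x, NormedAddCommGroup (F x)]
  [∀ x, InnerProductSpace ℂ (F x)]

/-- The sections whose fibrewise scalar product with every member of `S` is measurable. -/
def measurableAgainst (S : Set (∀ x, F x)) : Submodule ℂ (∀ x, F x) where
  carrier := {η | ∀ σ ∈ S, Measurable fun x => (inner ℂ (η x) (σ x) : ℂ)}
  zero_mem' := by
    intro σ _
    simp
  add_mem' := by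
    intro a b ha hb σ hσ
    simp only [Pi.add_apply, inner_add_left]
    exact (ha σ hσ).add (hb σ hσ)
  smul_mem' := by
    intro c a ha σ hσ
    simp only [Pi.smul_apply, inner_smul_left]
    exact (ha σ hσ).const_mul _

theorem measurable_inner_comm {η σ : ∀ x, F x}
    (h : Measurable fun x => (inner ℂ (η x) (σ x) : ℂ)) :
    Measurable fun x => (inner ℂ (σ x) (η x) : ℂ) := by
  have h' := (Complex.continuous_conj.measurable).comp h
  simpa only [Function.comp_def, inner_conj_symm] using h'

theorem measurable_norm_of_dense {ι : Type*} [Countable ι] {φ : ι → ∀ x, F x}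
    (hφ : ∀ i, Measurable fun x => ‖φ i x‖) (hd : ∀ x, Dense (Set.range fun i => φ i x))
    {η : ∀ x, F x} (hη : ∀ i, Measurable fun x => (inner ℂ (η x) (φ i x) : ℂ)) :
    Measurable fun x => ‖η x‖ := by
  have key : Measurable fun x => ‖η x‖ ^ 2 := by
    refine Measurable.isLUB
      (f := fun i x => 2 * (inner ℂ (η x) (φ i x) : ℂ).re - ‖φ i x‖ ^ 2) (fun i => ?_) fun x => ?_
    · exact ((Complex.measurable_re.comp (hη i)).const_mul 2).sub ((hφ i).pow_const 2)
    have hsq : ∀ i, 2 * (inner ℂ (η x) (φ i x) : ℂ).re - ‖φ i x‖ ^ 2 =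
        ‖η x‖ ^ 2 - ‖η x - φ i x‖ ^ 2 := by
      intro i
      have := norm_sub_sq (𝕜 := ℂ) (η x) (φ i x)
      simp only [RCLike.re_to_complex] at this
      linarith
    constructor
    · rintro a ⟨i, rfl⟩
      simp only [hsq]
      nlinarith [sq_nonneg ‖η x - φ i x‖]
    · intro b hb
      refine le_of_forall_pos_le_add fun ε hε => ?_
      obtain ⟨_, hy, i, rfl⟩ := Metric.dense_iff.1 (hd x) (η x) (Real.sqrt ε) (Real.sqrt_pos.2 hε)
      have h1 := hb ⟨i, rfl⟩
      simp only [hsq] at h1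
      rw [Metric.mem_ball, dist_comm, dist_eq_norm] at hy
      have h2 : ‖η x - φ i x‖ ^ 2 ≤ ε := by
        calc ‖η x - φ i x‖ ^ 2 ≤ Real.sqrt ε ^ 2 := by gcongr
          _ = ε := Real.sq_sqrt hε.le
      linarith
  have := Real.continuous_sqrt.measurable.comp key
  simpa [Function.comp_def, Real.sqrt_sq] using this

theorem measurable_inner_of_norm {M : Submodule ℂ (∀ x, F x)}
    (hM : ∀ ξ ∈ M, Measurable fun x => ‖ξ x‖) {η ζ : ∀ x, F x} (hη : η ∈ M) (hζ : ζ ∈ M) :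
    Measurable fun x => (inner ℂ (η x) (ζ x) : ℂ) := by
  have hs : ∀ ξ ∈ M, Measurable fun x => ((‖ξ x‖ : ℂ) ^ 2) := fun ξ hξ =>
    (Complex.measurable_ofReal.comp (hM ξ hξ)).pow_const 2
  have h1 := hs _ (M.add_mem hη hζ)
  have h2 := hs _ (M.sub_mem hη hζ)
  have h3 := hs _ (M.sub_mem hη (M.smul_mem Complex.I hζ))
  have h4 := hs _ (M.add_mem hη (M.smul_mem Complex.I hζ))
  simp only [Pi.add_apply, Pi.sub_apply, Pi.smul_apply] at h1 h2 h3 h4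
  simp only [inner_eq_sum_norm_sq_div_four, RCLike.I_to_complex]
  exact ((h1.sub h2).add ((h3.sub h4).mul_const _)).div_const _

theorem measurable_inner_of_dense {ι : Type*} [Countable ι] {φ : ι → ∀ x, F x}
    (hφ : ∀ i j, Measurable fun x => (inner ℂ (φ i x) (φ j x) : ℂ))
    (hd : ∀ x, Dense (Set.range fun i => φ i x)) {η ζ : ∀ x, F x}
    (hη : η ∈ measurableAgainst (Set.range φ)) (hζ : ζ ∈ measurableAgainst (Set.range φ)) :
    Measurable fun x => (inner ℂ (η x) (ζ x) : ℂ) := by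
  refine measurable_inner_of_norm (M := measurableAgainst (Set.range φ)) (fun ξ hξ => ?_) hη hζ
  refine measurable_norm_of_dense (φ := φ) (fun i => ?_) hd fun i => hξ _ ⟨i, rfl⟩
  have := Real.continuous_sqrt.measurable.comp (Complex.measurable_re.comp (hφ i i))
  simpa [Function.comp_def, inner_self_eq_norm_sq_to_K, ← Complex.ofReal_pow] using this

end Closure

/-- A measurable field of Hilbert spaces on `X`: a family of Hilbert spaces with a linear space of
measurable sections such that the norms of measurable sections are measurable functions, every
section whose scalar products with all measurable sections are measurable is itself measurable,
and there is a fundamental sequence. -/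
structure MeasurableField (X : Type u) [MeasurableSpace X] where
  /-- The Hilbert space over a point. -/
  fiber : X → Type v
  [normedAddCommGroup : ∀ x, NormedAddCommGroup (fiber x)]
  [innerProductSpace : ∀ x, InnerProductSpace ℂ (fiber x)]
  [completeSpace : ∀ x, CompleteSpace (fiber x)]
  /-- The measurable sections. -/
  sections : Submodule ℂ (∀ x, fiber x)
  measurable_norm : ∀ ξ ∈ sections, Measurable fun x => ‖ξ x‖
  mem_sections : ∀ η : ∀ x, fiber x,
    (∀ ξ ∈ sections, Measurable fun x => (inner ℂ (η x) (ξ x) : ℂ)) → η ∈ sections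
  exists_fundamental : ∃ ξ : ℕ → ∀ x, fiber x,
    (∀ i, ξ i ∈ sections) ∧ ∀ x, Dense (Set.range fun i => ξ i x)

namespace MeasurableField

attribute [instance] MeasurableField.normedAddCommGroup MeasurableField.innerProductSpace
  MeasurableField.completeSpace

variable {X : Type u} [MeasurableSpace X]

theorem measurable_inner (H : MeasurableField.{u, v} X) {η ζ : ∀ x, H.fiber x}
    (hη : η ∈ H.sections) (hζ : ζ ∈ H.sections) :
    Measurable fun x => (inner ℂ (η x) (ζ x) : ℂ) :=
  measurable_inner_of_norm H.measurable_norm hη hζ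

/-! ### The field with fibres `H_x ⊗ K` -/

section Tensor

variable (H : MeasurableField.{u, v} X) (K : Type w) [NormedAddCommGroup K]
  [InnerProductSpace ℂ K]

/-- The sections `x ↦ ξ x ⊗ k` with `ξ` a measurable section of `H` and `k` in `K`. -/
def elementarySections : Set (∀ x, HilbertTensor (H.fiber x) K) :=
  {σ | ∃ ξ ∈ H.sections, ∃ k : K, σ = fun x => HilbertTensor.tmul (ξ x) k}

variable {K} in
/-- The finite linear combinations, with algebraic numbers as coefficients, of the sections
`x ↦ ξ i x ⊗ ζ j`. -/
def algebraicCombination (ξ : ℕ → ∀ x, H.fiber x) (ζ : ℕ → K)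
    (c : (ℕ × ℕ) →₀ algebraicClosure ℚ ℂ) : ∀ x, HilbertTensor (H.fiber x) K :=
  fun x => ∑ p ∈ c.support, (c p : ℂ) • HilbertTensor.tmul (ξ p.1 x) (ζ p.2)


variable {H K} in
theorem algebraicCombination_apply (ξ : ℕ → ∀ x, H.fiber x) (ζ : ℕ → K)
    (c : (ℕ × ℕ) →₀ algebraicClosure ℚ ℂ) (x : X) :
    H.algebraicCombination ξ ζ c x =
      c.sum fun p a => (a : ℂ) • HilbertTensor.tmul (ξ p.1 x) (ζ p.2) := rfl

theorem elementarySections_subset :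
    H.elementarySections K ⊆ measurableAgainst (H.elementarySections K) := by
  rintro _ ⟨ξ, hξ, k, rfl⟩ _ ⟨ξ', hξ', k', rfl⟩
  simp only [HilbertTensor.inner_tmul]
  exact (H.measurable_inner hξ hξ').mul_const _

variable {H K} in
theorem algebraicCombination_mem {ξ : ℕ → ∀ x, H.fiber x} (hξ : ∀ i, ξ i ∈ H.sections)
    (ζ : ℕ → K) (c : (ℕ × ℕ) →₀ algebraicClosure ℚ ℂ) :
    H.algebraicCombination ξ ζ c ∈ measurableAgainst (H.elementarySections K) := by
  have : H.algebraicCombination ξ ζ c = ∑ p ∈ c.support,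
      ((c p : ℂ) • fun x => HilbertTensor.tmul (ξ p.1 x) (ζ p.2)) := by
    funext x
    simp [algebraicCombination]
  rw [this]
  exact Submodule.sum_mem _ fun p _ => Submodule.smul_mem _ _
    (H.elementarySections_subset K ⟨_, hξ p.1, _, rfl⟩)

variable {H K} in
theorem measurable_inner_algebraicCombination {ξ : ℕ → ∀ x, H.fiber x}
    (hξ : ∀ i, ξ i ∈ H.sections) (ζ : ℕ → K) (c : (ℕ × ℕ) →₀ algebraicClosure ℚ ℂ)
    {η : ∀ x, HilbertTensor (H.fiber x) K}
    (hη : η ∈ measurableAgainst (H.elementarySections K)) :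
    Measurable fun x => (inner ℂ (η x) (H.algebraicCombination ξ ζ c x) : ℂ) := by
  simp only [algebraicCombination, inner_sum, inner_smul_right]
  exact Finset.measurable_fun_sum _ fun p _ => (hη _ ⟨_, hξ p.1, _, rfl⟩).const_mul _

variable {H K} in
theorem dense_algebraicCombination {ξ : ℕ → ∀ x, H.fiber x}
    (hξ : ∀ x, Dense (Set.range fun i => ξ i x)) {ζ : ℕ → K} (hζ : DenseRange ζ) (x : X) :
    Dense (Set.range fun c => H.algebraicCombination ξ ζ c x) := by
  let S : AddSubmonoid (HilbertTensor (H.fiber x) K) :=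
    { carrier := Set.range fun c => H.algebraicCombination ξ ζ c x
      zero_mem' := ⟨0, by simp [algebraicCombination_apply]⟩
      add_mem' := by
        rintro _ _ ⟨c, rfl⟩ ⟨d, rfl⟩
        refine ⟨c + d, ?_⟩
        simp only [algebraicCombination_apply]
        exact Finsupp.sum_add_index' (by simp) (by simp [add_smul]) }
  intro t
  refine HilbertTensor.eq_top_of_tmul_mem S.topologicalClosure S.isClosed_topologicalClosure
    (fun e k => ?_) t
  have hd : DenseRange (Prod.map (fun i => ξ i x) ζ) := DenseRange.prodMap (hξ x) hζ
  refine closure_mono ?_ (HilbertTensor.continuous_tmul.range_subset_closure_image_dense hd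
    ⟨(e, k), rfl⟩)
  rintro _ ⟨_, ⟨⟨i, j⟩, rfl⟩, rfl⟩
  exact ⟨Finsupp.single (i, j) 1, by simp [algebraicCombination_apply]⟩

instance : Countable (algebraicClosure ℚ ℂ) :=
  (Algebraic.countable ℚ ℂ).mono fun _ hz => mem_algebraicClosure_iff.1 hz

/-- For a measurable field `H` and a separable Hilbert space `K`, the measurable field with fibre
`H_x ⊗ K` at `x`. A section is measurable when its scalar products with all the sections
`x ↦ ξ x ⊗ k`, `ξ` a measurable section of `H` and `k` in `K`, are measurable; see
`tensor_sections_eq` for the description by a fundamental sequence. -/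
def tensor [TopologicalSpace.SeparableSpace K] : MeasurableField.{u, max v w} X where
  fiber x := HilbertTensor (H.fiber x) K
  sections := measurableAgainst (H.elementarySections K)
  measurable_norm := by
    obtain ⟨ξ, hξ, hd⟩ := H.exists_fundamental
    have hK := TopologicalSpace.denseRange_denseSeq K
    intro η hη
    refine measurable_norm_of_dense (φ := H.algebraicCombination ξ (TopologicalSpace.denseSeq K))
      (fun c => ?_) (dense_algebraicCombination hd hK)
      (fun c => measurable_inner_algebraicCombination hξ _ c hη)
    have := Real.continuous_sqrt.measurable.comp (Complex.measurable_re.comp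
      (measurable_inner_algebraicCombination hξ (TopologicalSpace.denseSeq K) c
        (algebraicCombination_mem hξ (TopologicalSpace.denseSeq K) c)))
    simpa [Function.comp_def, inner_self_eq_norm_sq_to_K, ← Complex.ofReal_pow] using this
  mem_sections η hη σ hσ := hη σ (H.elementarySections_subset K hσ)
  exists_fundamental := by
    obtain ⟨ξ, hξ, hd⟩ := H.exists_fundamental
    obtain ⟨e, he⟩ := exists_surjective_nat ((ℕ × ℕ) →₀ algebraicClosure ℚ ℂ)
    refine ⟨fun n => H.algebraicCombination ξ (TopologicalSpace.denseSeq K) (e n),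
      fun n => algebraicCombination_mem hξ _ _, fun x => ?_⟩
    have := dense_algebraicCombination hd (TopologicalSpace.denseRange_denseSeq K) x
    rwa [← he.range_comp] at this

/-- The measurable sections of `H ⊗ K` are those whose scalar products with all finite linear
combinations, with algebraic coefficients, of tensor products of members of a fundamental
sequence of `H` and members of a dense sequence in `K` are measurable. -/
theorem tensor_sections_eq [TopologicalSpace.SeparableSpace K] {ξ : ℕ → ∀ x, H.fiber x}
    (hξ : ∀ i, ξ i ∈ H.sections) (hd : ∀ x, Dense (Set.range fun i => ξ i x)) {ζ : ℕ → K}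
    (hζ : DenseRange ζ) :
    (H.tensor K).sections = measurableAgainst (Set.range (H.algebraicCombination ξ ζ)) := by
  refine le_antisymm ?_ ?_
  · rintro η hη _ ⟨c, rfl⟩
    exact measurable_inner_algebraicCombination hξ ζ c hη
  · rintro η hη σ hσ
    refine measurable_inner_of_dense (φ := H.algebraicCombination ξ ζ) (fun c d => ?_)
      (dense_algebraicCombination hd hζ) hη ?_
    · exact measurable_inner_algebraicCombination hξ ζ d (algebraicCombination_mem hξ ζ c)
    · rintro _ ⟨c, rfl⟩
      exact measurable_inner_algebraicCombination hξ ζ c (H.elementarySections_subset K hσ)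

end Tensor

/-! ### Bounded fields of operators -/

/-- A bounded measurable field of bounded operators from `H` to `H'`. -/
structure Hom (H H' : MeasurableField.{u, v} X) where
  /-- The operator between the fibres over a point. -/
  toFun : ∀ x, H.fiber x →L[ℂ] H'.fiber x
  map_sections : ∀ ξ ∈ H.sections, (fun x => toFun x (ξ x)) ∈ H'.sections
  bounded : BddAbove (Set.range fun x => ‖toFun x‖)

/-- The bounded field of operators `x ↦ α_x ⊗ f` from `H ⊗ K` to `H' ⊗ K'`. -/
def Hom.tensor {H H' : MeasurableField.{u, v} X} {K K' : Type w} [NormedAddCommGroup K]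
    [InnerProductSpace ℂ K] [CompleteSpace K] [TopologicalSpace.SeparableSpace K]
    [NormedAddCommGroup K'] [InnerProductSpace ℂ K'] [CompleteSpace K']
    [TopologicalSpace.SeparableSpace K'] (α : Hom H H') (f : K →L[ℂ] K') :
    Hom (H.tensor K) (H'.tensor K') where
  toFun x := HilbertTensor.map (α.toFun x) f
  map_sections := by
    rintro η hη _ ⟨ξ, hξ, k, rfl⟩
    have h1 : (fun x => (α.toFun x).adjoint (ξ x)) ∈ H.sections := by
      refine H.mem_sections _ fun ζ hζ => ?_
      simp only [ContinuousLinearMap.adjoint_inner_left]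
      exact H'.measurable_inner hξ (α.map_sections ζ hζ)
    have h2 := hη _ ⟨_, h1, f.adjoint k, rfl⟩
    have h3 : (fun x => (inner ℂ (HilbertTensor.map (α.toFun x) f (η x))
        (HilbertTensor.tmul (ξ x) k) : ℂ)) = fun x => inner ℂ (η x)
        (HilbertTensor.tmul ((α.toFun x).adjoint (ξ x)) (f.adjoint k)) :=
      funext fun x => HilbertTensor.inner_map_tmul _ _ _ _ _
    exact h3 ▸ h2
  bounded := by
    obtain ⟨C, hC⟩ := α.bounded
    refine ⟨C * ‖f‖, ?_⟩
    rintro _ ⟨x, rfl⟩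
    exact (HilbertTensor.norm_map_le _ _).trans
      (mul_le_mul_of_nonneg_right (hC ⟨x, rfl⟩) (norm_nonneg _))

/-! ### The direct integral -/

section DirectIntegral

variable (μ : Measure X) (H : MeasurableField.{u, v} X)

/-- The `L²` sections of `H`. -/
def L2Sections : Submodule ℂ (∀ x, H.fiber x) where
  carrier := {ξ | ξ ∈ H.sections ∧ MemLp (fun x => ‖ξ x‖) 2 μ}
  zero_mem' := ⟨H.sections.zero_mem, by simp⟩
  add_mem' := by
    rintro ξ ζ ⟨hξ, hξ'⟩ ⟨hζ, hζ'⟩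
    refine ⟨H.sections.add_mem hξ hζ, (hξ'.add hζ').mono
      (H.measurable_norm _ (H.sections.add_mem hξ hζ)).aestronglyMeasurable ?_⟩
    refine Filter.Eventually.of_forall fun x => ?_
    simpa [abs_of_nonneg (add_nonneg (norm_nonneg (ξ x)) (norm_nonneg (ζ x)))] using
      norm_add_le (ξ x) (ζ x)
  smul_mem' := by
    rintro c ξ ⟨hξ, hξ'⟩
    refine ⟨H.sections.smul_mem c hξ, ?_⟩
    simpa [norm_smul] using hξ'.const_mul ‖c‖

/-- The sections that vanish almost everywhere. -/
def nullSections : Submodule ℂ (H.L2Sections μ) where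
  carrier := {ξ | ∀ᵐ x ∂μ, ξ.1 x = 0}
  zero_mem' := by simp
  add_mem' := by
    intro ξ ζ hξ hζ
    have h1 : ∀ᵐ x ∂μ, ξ.1 x = 0 := hξ
    have h2 : ∀ᵐ x ∂μ, ζ.1 x = 0 := hζ
    have h3 : ∀ᵐ x ∂μ, (ξ + ζ).1 x = 0 := by
      filter_upwards [h1, h2] with x h1 h2
      simp [h1, h2]
    exact h3
  smul_mem' := by
    intro c ξ hξ
    have h1 : ∀ᵐ x ∂μ, ξ.1 x = 0 := hξ
    have h2 : ∀ᵐ x ∂μ, (c • ξ).1 x = 0 := by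
      filter_upwards [h1] with x h1
      simp [h1]
    exact h2

/-- The direct integral `∫^⊕ H_x dμ(x)`: the `L²` sections modulo equality almost everywhere. -/
def DirectIntegral : Type (max u v) := (H.L2Sections μ) ⧸ (H.nullSections μ)

namespace DirectIntegral

instance : AddCommGroup (DirectIntegral μ H) :=
  inferInstanceAs (AddCommGroup ((H.L2Sections μ) ⧸ (H.nullSections μ)))

instance : Module ℂ (DirectIntegral μ H) :=
  inferInstanceAs (Module ℂ ((H.L2Sections μ) ⧸ (H.nullSections μ)))

variable {H}

/-- The class `∫^⊕ ξ x dμ(x)` of an `L²` section. -/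
def mk : H.L2Sections μ →ₗ[ℂ] DirectIntegral μ H := (H.nullSections μ).mkQ

variable {μ}

theorem mk_surjective : Function.Surjective (mk μ : H.L2Sections μ → DirectIntegral μ H) :=
  Submodule.mkQ_surjective _

theorem mk_eq_zero {ξ : H.L2Sections μ} : mk μ ξ = 0 ↔ ∀ᵐ x ∂μ, ξ.1 x = 0 :=
  Submodule.Quotient.mk_eq_zero (H.nullSections μ)

theorem mk_eq_mk {ξ ζ : H.L2Sections μ} : mk μ ξ = mk μ ζ ↔ ∀ᵐ x ∂μ, ξ.1 x = ζ.1 x := by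
  rw [← sub_eq_zero, ← map_sub, mk_eq_zero]
  simp [sub_eq_zero]

theorem integrable_inner (ξ ζ : H.L2Sections μ) :
    Integrable (fun x => (inner ℂ (ξ.1 x) (ζ.1 x) : ℂ)) μ := by
  refine (ξ.2.2.integrable_mul ζ.2.2).mono
    (H.measurable_inner ξ.2.1 ζ.2.1).aestronglyMeasurable (Filter.Eventually.of_forall fun x => ?_)
  simpa using norm_inner_le_norm (𝕜 := ℂ) (ξ.1 x) (ζ.1 x)

/-- The scalar product `⟪ξ, ζ⟫ = ∫ ⟪ξ x, ζ x⟫ dμ(x)`. -/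
instance : Inner ℂ (DirectIntegral μ H) where
  inner a b := Quotient.liftOn₂' a b (fun ξ ζ => ∫ x, (inner ℂ (ξ.1 x) (ζ.1 x) : ℂ) ∂μ) (by
    intro ξ ζ ξ' ζ' h h'
    have h1 : ∀ᵐ x ∂μ, ξ.1 x = ξ'.1 x := mk_eq_mk.1 (Quotient.sound' h)
    have h2 : ∀ᵐ x ∂μ, ζ.1 x = ζ'.1 x := mk_eq_mk.1 (Quotient.sound' h')
    refine integral_congr_ae ?_
    filter_upwards [h1, h2] with x e1 e2
    rw [e1, e2])

theorem inner_mk (ξ ζ : H.L2Sections μ) :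
    inner ℂ (mk μ ξ) (mk μ ζ) = ∫ x, (inner ℂ (ξ.1 x) (ζ.1 x) : ℂ) ∂μ := rfl

theorem inner_mk_self (ξ : H.L2Sections μ) :
    inner ℂ (mk μ ξ) (mk μ ξ) = ((∫ x, ‖ξ.1 x‖ ^ 2 ∂μ : ℝ) : ℂ) := by
  rw [inner_mk, ← integral_complex_ofReal]
  simp [inner_self_eq_norm_sq_to_K]

/-- The laws of the scalar product. -/
@[reducible] def core : InnerProductSpace.Core ℂ (DirectIntegral μ H) where
  conj_inner_symm a b := by
    obtain ⟨ξ, rfl⟩ := mk_surjective a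
    obtain ⟨ζ, rfl⟩ := mk_surjective b
    rw [inner_mk, inner_mk, ← integral_conj]
    simp only [inner_conj_symm]
  re_inner_nonneg a := by
    obtain ⟨ξ, rfl⟩ := mk_surjective a
    rw [inner_mk_self]
    simpa using integral_nonneg fun x => sq_nonneg ‖ξ.1 x‖
  add_left a b c := by
    obtain ⟨ξ, rfl⟩ := mk_surjective a
    obtain ⟨ζ, rfl⟩ := mk_surjective b
    obtain ⟨θ, rfl⟩ := mk_surjective c
    rw [← map_add, inner_mk, inner_mk, inner_mk,
      ← integral_add (integrable_inner ξ θ) (integrable_inner ζ θ)]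
    simp
  smul_left a b r := by
    obtain ⟨ξ, rfl⟩ := mk_surjective a
    obtain ⟨ζ, rfl⟩ := mk_surjective b
    rw [← map_smul, inner_mk, inner_mk, ← integral_const_mul]
    simp [mul_comm]
  definite a h := by
    obtain ⟨ξ, rfl⟩ := mk_surjective a
    rw [inner_mk_self, Complex.ofReal_eq_zero,
      integral_eq_zero_iff_of_nonneg (fun x => sq_nonneg _) ξ.2.2.integrable_sq] at h
    rw [mk_eq_zero]
    filter_upwards [h] with x hx
    simpa using hx

instance : NormedAddCommGroup (DirectIntegral μ H) :=
  InnerProductSpace.Core.toNormedAddCommGroup (cd := core)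

instance : InnerProductSpace ℂ (DirectIntegral μ H) := InnerProductSpace.ofCore core.toCore

theorem norm_mk_sq (ξ : H.L2Sections μ) : ‖mk μ ξ‖ ^ 2 = ∫ x, ‖ξ.1 x‖ ^ 2 ∂μ := by
  have h : ‖mk μ ξ‖ ^ 2 = RCLike.re (inner ℂ (mk μ ξ) (mk μ ξ) : ℂ) :=
    norm_sq_eq_re_inner (𝕜 := ℂ) _
  rw [h, inner_mk_self]
  exact Complex.ofReal_re _

theorem norm_mk_eq_norm_toLp (ξ : H.L2Sections μ) : ‖mk μ ξ‖ = ‖ξ.2.2.toLp _‖ := by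
  rw [← sq_eq_sq₀ (norm_nonneg _) (norm_nonneg _), norm_mk_sq, ← real_inner_self_eq_norm_sq,
    L2.inner_def]
  refine integral_congr_ae ?_
  filter_upwards [ξ.2.2.coeFn_toLp] with x hx
  simp [hx, sq]

theorem norm_mk_le (ξ : H.L2Sections μ) (W : Lp ℝ 2 μ) (h : ∀ᵐ x ∂μ, ‖ξ.1 x‖ ≤ W x) :
    ‖mk μ ξ‖ ≤ ‖W‖ := by
  rw [norm_mk_eq_norm_toLp]
  refine Lp.norm_le_norm_of_ae_le ?_
  filter_upwards [ξ.2.2.coeFn_toLp, h] with x hx h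
  rw [hx, norm_norm]
  exact h.trans (le_abs_self _)

instance : CompleteSpace (DirectIntegral μ H) := by
  refine NormedAddCommGroup.completeSpace_of_summable_imp_tendsto fun u hu => ?_
  choose ξ hξ using fun n => mk_surjective (u n)
  -- The pointwise norms are summable in the space of real square integrable functions.
  let v : ℕ → Lp ℝ 2 μ := fun n => (ξ n).2.2.toLp _
  have hv : Summable v := Summable.of_norm (by
    simpa only [v, ← norm_mk_eq_norm_toLp, hξ] using hu)
  set V : Lp ℝ 2 μ := ∑' n, v n with hV
  have hv0 : ∀ n, 0 ≤ v n := fun n => by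
    rw [← Lp.coeFn_nonneg]
    filter_upwards [(ξ n).2.2.coeFn_toLp] with x hx
    simp only [v, hx]
    exact norm_nonneg _
  have hsum : ∀ N, ∀ᵐ x ∂μ, (∑ n ∈ Finset.range N, v n : Lp ℝ 2 μ) x =
      ∑ n ∈ Finset.range N, ‖(ξ n).1 x‖ := by
    intro N
    induction N with
    | zero =>
      filter_upwards [Lp.coeFn_zero ℝ 2 μ] with x hx
      simpa using hx
    | succ N ih =>
      rw [Finset.sum_range_succ]
      filter_upwards [ih, Lp.coeFn_add (∑ n ∈ Finset.range N, v n) (v N),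
        (ξ N).2.2.coeFn_toLp] with x h1 h2 h3
      rw [h2, Pi.add_apply, h1, Finset.sum_range_succ]
      simp only [v, h3]
  have hle : ∀ᵐ x ∂μ, ∀ N, ∑ n ∈ Finset.range N, ‖(ξ n).1 x‖ ≤ V x := by
    rw [ae_all_iff]
    intro N
    have h : (∑ n ∈ Finset.range N, v n) ≤ V := hv.sum_le_tsum _ fun n _ => hv0 n
    rw [← Lp.coeFn_le] at h
    filter_upwards [h, hsum N] with x h1 h2
    rwa [h2] at h1
  -- The pointwise limit, on the measurable set where the series converges absolutely.
  let A : Set X := {x | ∑' n, ‖(ξ n).1 x‖ₑ < ⊤}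
  have hmeas : ∀ n, Measurable fun x => ‖(ξ n).1 x‖ := fun n =>
    H.measurable_norm _ (ξ n).2.1
  have hA : MeasurableSet A := by
    refine measurableSet_lt (Measurable.tsum fun n => ?_) measurable_const
    simpa only [ofReal_norm] using (hmeas n).ennreal_ofReal
  have hAs : ∀ x ∈ A, Summable fun n => ‖(ξ n).1 x‖ := by
    intro x hx
    have h2 : ∑' n, ((‖(ξ n).1 x‖₊ : NNReal) : ENNReal) ≠ ⊤ := ne_of_lt hx
    exact by
      simpa using NNReal.summable_coe.2 (ENNReal.tsum_coe_ne_top_iff_summable.1 h2)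
  have hAae : ∀ᵐ x ∂μ, x ∈ A := by
    filter_upwards [hle] with x hx
    have h1 : Summable fun n => ‖(ξ n).1 x‖ :=
      summable_of_sum_range_le (fun n => norm_nonneg _) hx
    have h2 : Summable fun n => ‖(ξ n).1 x‖₊ := NNReal.summable_coe.1 (by simpa using h1)
    exact lt_top_iff_ne_top.2 (ENNReal.tsum_coe_ne_top_iff_summable.2 h2)
  classical
  let S : ℕ → ∀ x, H.fiber x := fun N x => ∑ n ∈ Finset.range N, (ξ n).1 x
  let f : ∀ x, H.fiber x := fun x => if x ∈ A then ∑' n, (ξ n).1 x else 0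
  have hSf : ∀ x ∈ A, Filter.Tendsto (fun N => S N x) Filter.atTop (nhds (f x)) := by
    intro x hx
    simp only [f, hx, if_true]
    exact (hAs x hx).of_norm.hasSum.tendsto_sum_nat
  have hSmem : ∀ N, S N ∈ H.sections := by
    intro N
    have : S N = ∑ n ∈ Finset.range N, (ξ n).1 := by
      funext x
      simp [S]
    rw [this]
    exact Submodule.sum_mem _ fun n _ => (ξ n).2.1
  have hf : f ∈ H.sections := by
    refine H.mem_sections f fun ζ hζ => ?_
    refine measurable_of_tendsto_metrizable
      (f := fun N => A.indicator fun x => (inner ℂ (S N x) (ζ x) : ℂ))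
      (fun N => (H.measurable_inner (hSmem N) hζ).indicator hA) ?_
    rw [tendsto_pi_nhds]
    intro x
    by_cases hx : x ∈ A
    · simp only [Set.indicator_of_mem hx]
      exact (hSf x hx).inner tendsto_const_nhds
    · simp [f, hx]
  have hbound : ∀ᵐ x ∂μ, ∀ N, ‖f x - S N x‖ ≤ V x - ∑ n ∈ Finset.range N, ‖(ξ n).1 x‖ := by
    filter_upwards [hle, hAae] with x hx hxA N
    refine le_of_tendsto ((hSf x hxA).sub_const (S N x)).norm ?_
    filter_upwards [Filter.eventually_ge_atTop N] with M hM
    have h1 : S M x - S N x = ∑ n ∈ Finset.Ico N M, (ξ n).1 x :=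
      (Finset.sum_Ico_eq_sub _ hM).symm
    have h2 := Finset.sum_Ico_eq_sub (fun n => ‖(ξ n).1 x‖) hM
    rw [h1]
    refine (norm_sum_le _ _).trans ?_
    rw [h2]
    linarith [hx M]
  have hfL : MemLp (fun x => ‖f x‖) 2 μ := by
    refine (Lp.memLp V).mono (H.measurable_norm f hf).aestronglyMeasurable ?_
    filter_upwards [hbound] with x hx
    have := hx 0
    simp only [S, Finset.range_zero, Finset.sum_empty, sub_zero] at this
    rw [norm_norm]
    exact this.trans (le_abs_self _)
  refine ⟨mk μ ⟨f, hf, hfL⟩, ?_⟩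
  rw [tendsto_iff_norm_sub_tendsto_zero]
  have hlim : Filter.Tendsto (fun N => ‖V - ∑ n ∈ Finset.range N, v n‖) Filter.atTop (nhds 0) := by
    have h1 := hv.hasSum.tendsto_sum_nat
    rw [tendsto_iff_norm_sub_tendsto_zero] at h1
    simpa only [norm_sub_rev, hV] using h1
  refine squeeze_zero (fun N => norm_nonneg _) (fun N => ?_) hlim
  have h1 : (∑ n ∈ Finset.range N, u n) - mk μ ⟨f, hf, hfL⟩ =
      -(mk μ (⟨f, hf, hfL⟩ - ∑ n ∈ Finset.range N, ξ n)) := by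
    rw [map_sub, map_sum]
    simp only [hξ, neg_sub]
  rw [h1, norm_neg]
  refine norm_mk_le _ _ ?_
  filter_upwards [hbound, hsum N, Lp.coeFn_sub V (∑ n ∈ Finset.range N, v n)] with x hx h2 h3
  rw [h3, Pi.sub_apply, h2]
  simpa [S] using hx N

theorem memLp_apply {H' : MeasurableField.{u, v} X} (α : Hom H H') (ξ : H.L2Sections μ) :
    MemLp (fun x => ‖α.toFun x (ξ.1 x)‖) 2 μ := by
  obtain ⟨C, hC⟩ := α.bounded
  refine (ξ.2.2.const_mul C).mono
    (H'.measurable_norm _ (α.map_sections _ ξ.2.1)).aestronglyMeasurable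
    (Filter.Eventually.of_forall fun x => ?_)
  rw [norm_norm]
  exact (((α.toFun x).le_opNorm _).trans
    (mul_le_mul_of_nonneg_right (hC ⟨x, rfl⟩) (norm_nonneg _))).trans (le_abs_self _)

variable (μ) in
/-- The action `ξ ↦ (x ↦ α x (ξ x))` of a bounded field of operators on `L²` sections. -/
def mapSections {H' : MeasurableField.{u, v} X} (α : Hom H H') :
    H.L2Sections μ →ₗ[ℂ] H'.L2Sections μ where
  toFun ξ := ⟨fun x => α.toFun x (ξ.1 x), α.map_sections _ ξ.2.1, memLp_apply α ξ⟩
  map_add' ξ ζ := by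
    ext x
    simp
  map_smul' c ξ := by
    ext x
    simp

variable (μ) in
/-- The operator `∫^⊕ α x dμ(x)` that sends the class of `ξ` to the class of `x ↦ α x (ξ x)`. -/
def map {H' : MeasurableField.{u, v} X} (α : Hom H H') :
    DirectIntegral μ H →L[ℂ] DirectIntegral μ H' :=
  LinearMap.mkContinuousOfExistsBound
    ((H.nullSections μ).liftQ (mk μ ∘ₗ mapSections μ α) (by
      intro ξ hξ
      refine mk_eq_zero.2 (Filter.Eventually.mono hξ fun x h => ?_)
      simp [mapSections, h]) : DirectIntegral μ H →ₗ[ℂ] DirectIntegral μ H') (by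
    obtain ⟨C, hC⟩ := α.bounded
    refine ⟨max C 0, fun a => ?_⟩
    obtain ⟨ξ, rfl⟩ := mk_surjective a
    change ‖mk μ (mapSections μ α ξ)‖ ≤ _
    have hL : ‖mk μ ξ‖ = ‖ξ.2.2.toLp _‖ := norm_mk_eq_norm_toLp ξ
    rw [hL, ← abs_of_nonneg (le_max_right C 0), ← Real.norm_eq_abs, ← norm_smul]
    refine norm_mk_le _ _ ?_
    filter_upwards [Lp.coeFn_smul (max C 0) (ξ.2.2.toLp _), ξ.2.2.coeFn_toLp] with x h1 h2
    rw [h1, Pi.smul_apply, h2, smul_eq_mul]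
    exact ((α.toFun x).le_opNorm _).trans (mul_le_mul_of_nonneg_right
      ((hC ⟨x, rfl⟩).trans (le_max_left _ _)) (norm_nonneg _)))

theorem map_mk {H' : MeasurableField.{u, v} X} (α : Hom H H') (ξ : H.L2Sections μ) :
    map μ α (mk μ ξ) = mk μ (mapSections μ α ξ) := rfl

/-- The `L²` section `x ↦ ξ x ⊗ k` of `H ⊗ K`. -/
def tmulSection {K : Type w} [NormedAddCommGroup K] [InnerProductSpace ℂ K]
    [TopologicalSpace.SeparableSpace K] (ξ : H.L2Sections μ) (k : K) :
    (H.tensor K).L2Sections μ :=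
  ⟨fun x => HilbertTensor.tmul (ξ.1 x) k, H.elementarySections_subset K ⟨ξ.1, ξ.2.1, k, rfl⟩, by
    have h : (fun x => ‖ξ.1 x‖ * ‖k‖) = fun x => ‖HilbertTensor.tmul (ξ.1 x) k‖ :=
      funext fun x => (HilbertTensor.norm_tmul _ _).symm
    exact h ▸ ξ.2.2.mul_const ‖k‖⟩

end DirectIntegral

end DirectIntegral

end MeasurableField

end

/-! The isomorphism is constructed backwards. Sending the class of `ξ` and `k` to the class of `x ↦
ξ x ⊗ k` is bilinear and multiplies scalar products, because `⟪k, l⟫` is a constant that comes out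
of the integral (`inner_tmulBilin`). It therefore extends to an isometry `tensorIsometry` from the
completed tensor product into the direct integral of the `H_x ⊗ K`, and `Φ` is its inverse.

The content is surjectivity. The range is closed, so it suffices that a section `η` orthogonal to
all `ξ ⊗ k` is null. Measurable sections may be multiplied by measurable scalar functions, so
vanishing of the integrated scalar products forces `⟪ξ x ⊗ k, η x⟫ = 0` for almost every `x`
(`ae_inner_tmul_eq_zero`); `σ`-finiteness supplies a weight that makes the test section square
integrable. Letting `ξ` and `k` run through countable dense families leaves a single null set, off
which `η x` is orthogonal to a total set of `H_x ⊗ K`.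

Canonicity holds by construction. Naturality is an identity of continuous operators, tested on
elementary tensors (`map_tensorIsometry`). -/

noncomputable section

/-! ### Elementary tensors: bilinearity and totality. -/

namespace HilbertTensor

variable {E F : Type*} [NormedAddCommGroup E] [InnerProductSpace ℂ E]
  [NormedAddCommGroup F] [InnerProductSpace ℂ F]

theorem add_tmul (a b : E) (k : F) : tmul (a + b) k = tmul a k + tmul b k := by
  simp only [tmul, TensorProduct.add_tmul, Completion.coe_add]

theorem tmul_add (a : E) (k l : F) : tmul a (k + l) = tmul a k + tmul a l := by
  simp only [tmul, TensorProduct.tmul_add, Completion.coe_add]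

theorem smul_tmul (c : ℂ) (a : E) (k : F) : tmul (c • a) k = c • tmul a k := by
  simp only [tmul, ← TensorProduct.smul_tmul', Completion.coe_smul]

theorem tmul_smul (c : ℂ) (a : E) (k : F) : tmul a (c • k) = c • tmul a k := by
  simp only [tmul, TensorProduct.tmul_smul, Completion.coe_smul]

/-- Two continuous linear maps that agree on elementary tensors are equal. -/
theorem ext_tmul {G : Type*} [NormedAddCommGroup G] [NormedSpace ℂ G]
    {f g : HilbertTensor E F →L[ℂ] G} (h : ∀ e k, f (tmul e k) = g (tmul e k)) : f = g := by
  ext t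
  exact eq_top_of_tmul_mem (LinearMap.eqLocus (f : _ →ₗ[ℂ] G) (g : _ →ₗ[ℂ] G)).toAddSubmonoid
    (isClosed_eq f.continuous g.continuous) h t

variable (F) in
/-- A vector orthogonal to the elementary tensors of members of dense families is zero. -/
theorem eq_zero_of_inner_tmul_eq_zero {ι κ : Type*} {φ : ι → E} (hφ : DenseRange φ) {ζ : κ → F}
    (hζ : DenseRange ζ) {t : HilbertTensor E F}
    (h : ∀ i j, (inner ℂ (tmul (φ i) (ζ j)) t : ℂ) = 0) : t = 0 := by
  have h1 : ∀ p : E × F, (inner ℂ (tmul p.1 p.2) t : ℂ) = 0 := by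
    refine fun p => (hφ.prodMap hζ).induction_on p
      (isClosed_eq (continuous_tmul.inner continuous_const) continuous_const) fun q => h q.1 q.2
  -- The functional `⟪t, ·⟫` is continuous and kills the elementary tensors, so it vanishes;
  -- evaluating it at `t` gives `‖t‖ = 0`.
  have h2 : innerSL ℂ t = 0 := ext_tmul fun e k => by
    exact inner_eq_zero_symm.1 (h1 (e, k))
  have h3 : (innerSL ℂ t) t = 0 := by rw [h2]; rfl
  rwa [innerSL_apply_apply, inner_self_eq_zero] at h3

end HilbertTensor

/-! ### Square integrable weights. -/

/-- On a `σ`-finite measure space there is a positive square integrable function. -/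
theorem MeasureTheory.exists_pos_measurable_memLp_two {X : Type*} [MeasurableSpace X]
    (μ : Measure X) [SigmaFinite μ] :
    ∃ w : X → ℝ, (∀ x, 0 < w x) ∧ Measurable w ∧ MemLp w 2 μ := by
  -- The bound `1` is arbitrary: only the finiteness of the integral of `g` matters, since the
  -- weight is the square root of `g`.
  obtain ⟨g, hpos, hg, hint⟩ := exists_pos_lintegral_lt_of_sigmaFinite μ one_ne_zero
  have hm : Measurable fun x => Real.sqrt (g x) :=
    Real.continuous_sqrt.measurable.comp hg.coe_nnreal_real
  refine ⟨fun x => Real.sqrt (g x), fun x => Real.sqrt_pos.2 (hpos x), hm, ?_⟩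
  rw [memLp_two_iff_integrable_sq hm.aestronglyMeasurable]
  simp only [Real.sq_sqrt (NNReal.coe_nonneg _)]
  refine ⟨hg.coe_nnreal_real.aestronglyMeasurable, ?_⟩
  simpa [HasFiniteIntegral] using hint.trans ENNReal.one_lt_top

/-! ### The canonical isometry. -/

namespace MeasurableField

variable {X : Type u} [MeasurableSpace X]

/-- Closure axiom (2) applies, since scalar products with measurable sections only acquire the
factor `conj g`. This is what allows test sections to be localized in `x`. -/
theorem smul_mem_sections (H : MeasurableField.{u, v} X) {g : X → ℂ} (hg : Measurable g)
    {ξ : ∀ x, H.fiber x} (hξ : ξ ∈ H.sections) : (fun x => g x • ξ x) ∈ H.sections := by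
  refine H.mem_sections _ fun ζ hζ => ?_
  simp only [inner_smul_left]
  exact (Complex.continuous_conj.measurable.comp hg).mul (H.measurable_inner hξ hζ)

namespace DirectIntegral

variable {μ : Measure X} {H H' : MeasurableField.{u, v} X}
  {K K' : Type w} [NormedAddCommGroup K] [InnerProductSpace ℂ K]
  [TopologicalSpace.SeparableSpace K]

variable (μ H K) in
/-- The bilinear map that sends the class of `ξ` and `k` to the class of `x ↦ ξ x ⊗ k`. -/
def tmulBilin : DirectIntegral μ H →ₗ[ℂ] K →ₗ[ℂ] DirectIntegral μ (H.tensor K) :=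
  (H.nullSections μ).liftQ
    (LinearMap.mk₂ ℂ (fun (ξ : H.L2Sections μ) (k : K) => mk μ (tmulSection ξ k))
      (fun ξ ζ k => by
        rw [← map_add]
        exact congrArg _ (Subtype.ext (funext fun x => HilbertTensor.add_tmul _ _ _)))
      (fun c ξ k => by
        rw [← map_smul]
        exact congrArg _ (Subtype.ext (funext fun x => HilbertTensor.smul_tmul _ _ _)))
      (fun ξ k l => by
        rw [← map_add]
        exact congrArg _ (Subtype.ext (funext fun x => HilbertTensor.tmul_add _ _ _)))
      (fun c ξ k => by
        rw [← map_smul]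
        exact congrArg _ (Subtype.ext (funext fun x => HilbertTensor.tmul_smul _ _ _))))
    (by
      intro ξ hξ
      ext k
      refine mk_eq_zero.2 (Filter.Eventually.mono hξ fun x h => ?_)
      change HilbertTensor.tmul (ξ.1 x) k = 0
      -- `0 ⊗ k = 0` follows by writing `0` as `0 • 0` and pulling the scalar out.
      rw [h, ← zero_smul ℂ (0 : H.fiber x), HilbertTensor.smul_tmul, zero_smul])

theorem tmulBilin_mk (ξ : H.L2Sections μ) (k : K) :
    tmulBilin μ H K (mk μ ξ) k = mk μ (tmulSection ξ k) := rfl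

/-- Fibrewise the scalar product is `⟪ξ x, ζ x⟫ * ⟪k, l⟫`, and the second factor does not depend on
`x`. -/
theorem inner_tmulBilin (a b : DirectIntegral μ H) (k l : K) :
    (inner ℂ (tmulBilin μ H K a k) (tmulBilin μ H K b l) : ℂ) = inner ℂ a b * inner ℂ k l := by
  obtain ⟨ξ, rfl⟩ := mk_surjective a
  obtain ⟨ζ, rfl⟩ := mk_surjective b
  rw [tmulBilin_mk, tmulBilin_mk, inner_mk, inner_mk, ← integral_mul_const]
  exact integral_congr_ae (Filter.Eventually.of_forall fun x => HilbertTensor.inner_tmul _ _ _ _)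

variable (μ H K) in
/-- The isometry `a ⊗ k ↦ tmulBilin a k` on the algebraic tensor product. -/
def algTensorIsometry : DirectIntegral μ H ⊗[ℂ] K →ₗᵢ[ℂ] DirectIntegral μ (H.tensor K) :=
  (TensorProduct.lift (tmulBilin μ H K)).isometryOfInner (by
    intro s t
    induction s using TensorProduct.induction_on with
    | zero => simp
    | add s s' hs hs' => rw [map_add, inner_add_left, inner_add_left, hs, hs']
    | tmul a k =>
      induction t using TensorProduct.induction_on with
      | zero => simp
      | add t t' ht ht' => rw [map_add, inner_add_right, inner_add_right, ht, ht']
      | tmul b l =>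
        rw [TensorProduct.lift.tmul, TensorProduct.lift.tmul, TensorProduct.inner_tmul,
          inner_tmulBilin])

variable (μ H K) in
/-- The isometry from the Hilbert space tensor product to the direct integral of the `H_x ⊗ K`. -/
def tensorIsometry :
    HilbertTensor (DirectIntegral μ H) K →ₗᵢ[ℂ] DirectIntegral μ (H.tensor K) where
  toLinearMap := ((algTensorIsometry μ H K).toContinuousLinearMap.extend
    (Completion.toComplL : _ →L[ℂ] HilbertTensor (DirectIntegral μ H) K) :
      HilbertTensor (DirectIntegral μ H) K →L[ℂ] DirectIntegral μ (H.tensor K))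
  norm_map' t := by
    induction t using Completion.induction_on with
    | hp => exact isClosed_eq (ContinuousLinearMap.continuous _).norm continuous_norm
    | ih t =>
      -- On the dense algebraic tensor product the extension agrees with `algTensorIsometry`, which
      -- preserves norms.
      rw [Completion.norm_coe, ← (algTensorIsometry μ H K).norm_map]
      exact congrArg norm (ContinuousLinearMap.extend_eq _ Completion.denseRange_coe
        (Completion.isUniformInducing_coe _) t)

theorem tensorIsometry_tmul (a : DirectIntegral μ H) (k : K) :
    tensorIsometry μ H K (HilbertTensor.tmul a k) = tmulBilin μ H K a k :=
  ContinuousLinearMap.extend_eq (algTensorIsometry μ H K).toContinuousLinearMap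
    Completion.denseRange_coe (Completion.isUniformInducing_coe _) (a ⊗ₜ k)

theorem tensorIsometry_tmul_mk (ξ : H.L2Sections μ) (k : K) :
    tensorIsometry μ H K (HilbertTensor.tmul (mk μ ξ) k) = mk μ (tmulSection ξ k) := by
  rw [tensorIsometry_tmul, tmulBilin_mk]

/-! ### Surjectivity. -/

/-- If an `L²` section of `H ⊗ K` is orthogonal to all `x ↦ ζ x ⊗ k` with `ζ` an `L²` section
of `H`, then it is almost everywhere orthogonal to `ξ x ⊗ k` for each measurable section `ξ`. -/
theorem ae_inner_tmul_eq_zero [SigmaFinite μ] {η : (H.tensor K).L2Sections μ} {k : K}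
    (hη : ∀ ζ : H.L2Sections μ, (inner ℂ (mk μ (tmulSection ζ k)) (mk μ η) : ℂ) = 0)
    {ξ : ∀ x, H.fiber x} (hξ : ξ ∈ H.sections) :
    ∀ᵐ x ∂μ, (inner ℂ (HilbertTensor.tmul (ξ x) k) (η.1 x : HilbertTensor (H.fiber x) K) : ℂ)
      = 0 := by
  obtain ⟨w, hw0, hwm, hw⟩ := exists_pos_measurable_memLp_two μ
  let g : X → ℂ := fun x =>
    inner ℂ (HilbertTensor.tmul (ξ x) k) (η.1 x : HilbertTensor (H.fiber x) K)
  have hg : Measurable g := measurable_inner_comm (η.2.1 _ ⟨ξ, hξ, k, rfl⟩)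
  -- The denominator is chosen so that `r * ‖g‖ * ‖ξ‖ ≤ w`; the summands `1` keep it positive where
  -- `ξ` or `g` vanishes.
  let r : X → ℝ := fun x => w x / ((1 + ‖ξ x‖) * (1 + ‖g x‖))
  have hr0 : ∀ x, 0 < r x := fun x => div_pos (hw0 x) (by positivity)
  have hr : Measurable r :=
    hwm.div ((measurable_const.add (H.measurable_norm ξ hξ)).mul (measurable_const.add hg.norm))
  have hrg : Measurable fun x => (r x : ℂ) * g x := (Complex.measurable_ofReal.comp hr).mul hg
  -- The weight makes the section `x ↦ r x * g x • ξ x` square integrable.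
  have hζ : (fun x => ((r x : ℂ) * g x) • ξ x) ∈ H.sections := H.smul_mem_sections hrg hξ
  have hζL : MemLp (fun x => ‖((r x : ℂ) * g x) • ξ x‖) 2 μ := by
    refine hw.mono (H.measurable_norm _ hζ).aestronglyMeasurable
      (Filter.Eventually.of_forall fun x => ?_)
    rw [norm_norm, norm_smul, norm_mul, Complex.norm_real, Real.norm_of_nonneg (hr0 x).le,
      Real.norm_of_nonneg (hw0 x).le]
    have h1 : r x * ((1 + ‖ξ x‖) * (1 + ‖g x‖)) = w x := div_mul_cancel₀ _ (by positivity)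
    rw [← h1, mul_assoc]
    refine mul_le_mul_of_nonneg_left ?_ (hr0 x).le
    nlinarith [norm_nonneg (ξ x), norm_nonneg (g x)]
  let ζ : H.L2Sections μ := ⟨_, hζ, hζL⟩
  -- The factor `g x` in the test section is conjugated by the first slot of the scalar product and
  -- meets another `g x`, which makes the integrand nonnegative.
  have hpt : ∀ x, (inner ℂ ((tmulSection ζ k).1 x) (η.1 x) : ℂ) = ((r x * ‖g x‖ ^ 2 : ℝ) : ℂ) := by
    intro x
    change (inner ℂ (HilbertTensor.tmul (((r x : ℂ) * g x) • ξ x) k)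
      (η.1 x : HilbertTensor (H.fiber x) K) : ℂ) = _
    rw [HilbertTensor.smul_tmul]
    refine (inner_smul_left _ _ _).trans ?_
    change (starRingEnd ℂ) ((r x : ℂ) * g x) * g x = _
    rw [map_mul, Complex.conj_ofReal, mul_assoc, Complex.conj_mul']
    push_cast
    rfl
  have hint := integrable_inner (tmulSection ζ k) η
  have h0 := hη ζ
  rw [inner_mk] at h0
  simp only [hpt] at hint h0
  -- A nonnegative integrable function with integral zero vanishes almost everywhere; as `r` is
  -- positive, so does `g`.
  rw [integral_complex_ofReal, Complex.ofReal_eq_zero,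
    integral_eq_zero_iff_of_nonneg (fun x => mul_nonneg (hr0 x).le (sq_nonneg _))
      (by simpa only [RCLike.re_to_complex, Complex.ofReal_re] using hint.re)] at h0
  filter_upwards [h0] with x hx
  simpa [(hr0 x).ne'] using hx

/-- An isometry on a complete space has closed range, so a trivial orthogonal complement suffices.
-/
theorem tensorIsometry_surjective [SigmaFinite μ] :
    Function.Surjective (tensorIsometry μ H K) := by
  have hcl : IsClosed (LinearMap.range (tensorIsometry μ H K).toLinearMap :
      Set (DirectIntegral μ (H.tensor K))) :=
    (tensorIsometry μ H K).isometry.isClosedEmbedding.isClosed_range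
  suffices h : LinearMap.range (tensorIsometry μ H K).toLinearMap = ⊤ from
    LinearMap.range_eq_top.1 h
  rw [← hcl.submodule_topologicalClosure_eq, Submodule.topologicalClosure_eq_top_iff,
    Submodule.eq_bot_iff]
  intro a ha
  obtain ⟨η, rfl⟩ := mk_surjective a
  obtain ⟨ξ, hξ, hd⟩ := H.exists_fundamental
  have h : ∀ i j, ∀ᵐ x ∂μ, (inner ℂ (HilbertTensor.tmul (ξ i x) (TopologicalSpace.denseSeq K j))
      (η.1 x : HilbertTensor (H.fiber x) K) : ℂ) = 0 := fun i j =>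
    ae_inner_tmul_eq_zero (fun ζ => by
      rw [← tensorIsometry_tmul_mk]
      exact ha _ ⟨_, rfl⟩) (hξ i)
  rw [mk_eq_zero]
  -- The pairs `(i, j)` are countable, so one null set serves them all; off it, density in each
  -- fibre gives `η x = 0`.
  filter_upwards [ae_all_iff.2 fun i => ae_all_iff.2 (h i)] with x hx
  exact HilbertTensor.eq_zero_of_inner_tmul_eq_zero K (hd x)
    (TopologicalSpace.denseRange_denseSeq K) hx

/-! ### The isomorphism and its naturality. -/

variable (μ H K) in
/-- The canonical isomorphism from the direct integral of the `H_x ⊗ K` to the tensor product of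
the direct integral of `H` with `K`. -/
def tensorEquiv [SigmaFinite μ] :
    DirectIntegral μ (H.tensor K) ≃ₗᵢ[ℂ] HilbertTensor (DirectIntegral μ H) K :=
  (LinearIsometryEquiv.ofSurjective (tensorIsometry μ H K) tensorIsometry_surjective).symm

theorem tensorEquiv_tensorIsometry [SigmaFinite μ] (t : HilbertTensor (DirectIntegral μ H) K) :
    tensorEquiv μ H K (tensorIsometry μ H K t) = t :=
  (LinearIsometryEquiv.ofSurjective _ tensorIsometry_surjective).symm_apply_apply t

variable [CompleteSpace K] [NormedAddCommGroup K'] [InnerProductSpace ℂ K'] [CompleteSpace K']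
  [TopologicalSpace.SeparableSpace K']

/-- This is naturality of the inverse of `Φ`. By continuity it reduces to `mk μ ξ ⊗ k`, where both
sides are the class of `x ↦ α_x (ξ x) ⊗ f k`. -/
theorem map_tensorIsometry (α : Hom H H') (f : K →L[ℂ] K')
    (t : HilbertTensor (DirectIntegral μ H) K) :
    map μ (α.tensor f) (tensorIsometry μ H K t) =
      tensorIsometry μ H' K' (HilbertTensor.map (map μ α) f t) := by
  have h : map μ (α.tensor f) ∘L (tensorIsometry μ H K).toContinuousLinearMap =
      (tensorIsometry μ H' K').toContinuousLinearMap ∘L HilbertTensor.map (map μ α) f := by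
    refine HilbertTensor.ext_tmul fun a k => ?_
    obtain ⟨ξ, rfl⟩ := mk_surjective a
    change map μ (α.tensor f) (tensorIsometry μ H K _) = tensorIsometry μ H' K'
      (HilbertTensor.map (map μ α) f _)
    rw [HilbertTensor.map_tmul, map_mk, tensorIsometry_tmul_mk, tensorIsometry_tmul_mk, map_mk]
    exact congrArg _ (Subtype.ext (funext fun x => HilbertTensor.map_tmul _ _ _ _))
  exact congrArg (fun T => T t) h

end DirectIntegral

end MeasurableField

end

theorem theorem43 {X : Type u} [MeasurableSpace X] (μ : Measure X) [SigmaFinite μ] :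
    ∃ Φ : ∀ (H : MeasurableField.{u, v} X) (K : Type w) [NormedAddCommGroup K]
        [InnerProductSpace ℂ K] [CompleteSpace K] [TopologicalSpace.SeparableSpace K],
        MeasurableField.DirectIntegral μ (H.tensor K) ≃ₗᵢ[ℂ]
          HilbertTensor (MeasurableField.DirectIntegral μ H) K,
      (∀ (H : MeasurableField.{u, v} X) (K : Type w) [NormedAddCommGroup K]
        [InnerProductSpace ℂ K] [CompleteSpace K] [TopologicalSpace.SeparableSpace K]
        (ξ : H.L2Sections μ) (k : K),
        Φ H K (MeasurableField.DirectIntegral.mk μ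
            (MeasurableField.DirectIntegral.tmulSection ξ k)) =
          HilbertTensor.tmul (MeasurableField.DirectIntegral.mk μ ξ) k) ∧
      (∀ (H H' : MeasurableField.{u, v} X) (α : MeasurableField.Hom H H')
        (K K' : Type w) [NormedAddCommGroup K] [InnerProductSpace ℂ K] [CompleteSpace K]
        [TopologicalSpace.SeparableSpace K] [NormedAddCommGroup K'] [InnerProductSpace ℂ K']
        [CompleteSpace K'] [TopologicalSpace.SeparableSpace K'] (f : K →L[ℂ] K')
        (a : MeasurableField.DirectIntegral μ (H.tensor K)),
        Φ H' K' (MeasurableField.DirectIntegral.map μ (α.tensor f) a) =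
          HilbertTensor.map (MeasurableField.DirectIntegral.map μ α) f (Φ H K a)) := by
  refine ⟨fun H K _ _ _ _ => MeasurableField.DirectIntegral.tensorEquiv μ H K, ?_, ?_⟩
  · intro H K _ _ _ _ ξ k
    rw [← MeasurableField.DirectIntegral.tensorIsometry_tmul_mk]
    exact MeasurableField.DirectIntegral.tensorEquiv_tensorIsometry _
  · intro H H' α K K' _ _ _ _ _ _ _ _ f a
    -- Writing `a` as the image of `t` turns naturality of `Φ` into that of its inverse.
    obtain ⟨t, rfl⟩ := MeasurableField.DirectIntegral.tensorIsometry_surjective a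
    rw [MeasurableField.DirectIntegral.map_tensorIsometry,
      MeasurableField.DirectIntegral.tensorEquiv_tensorIsometry,
      MeasurableField.DirectIntegral.tensorEquiv_tensorIsometry]
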